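/- For every $n\ge 1$ let $X_{n,1},\dots,X_{n,n}$ be independent real random variables on a probability space $(\Omega_n,P_n)$ (a triangular array; the laws may differ in $i$ and change with $n$), each with a law that is absolutely continuous with respect to Lebesgue measure. Write $X_i=X_{n,i}$, $P=P_n$, $[n]=\{1,\dots,n\}$, and let $$U_n^{\rm AP}=U_n^{\rm AP}(X_1,\dots,X_n)=\frac1{n(n-1)}\sum_{1\le i\ne j\le n}\frac{n\,\mathbf 1(j<i)}{i-1}\,\mathbf 1(X_j>X_i),\qquad \sigma_n^2={\rm Var}(U_n^{\rm AP}),\ \ \sigma_n\ge 0,$$ with the convention $0/0=0$. For real sequences write $a_n\gtrsim b_n$ if $|b_n|\le C|a_n|$ for some constant $C$ and all large $n$. Assume that there are sequences $\delta_n,p_n\in(0,1)$ such that for all sufficiently large $n$ and every $i\in[n]$ at least one of the following holds: (i) $P\{P(X_j>X_i\mid X_i)-P(X_j>X_i)\in[\delta_n,1]\ \text{for all } j\in[n]\setminus\{i\}\}\ge p_n$; (ii) $P\{P(X_j>X_i\mid X_i)-P(X_j>X_i)\in[-1,-\delta_n]\ \text{for all } j\in[n]\setminus\{i\}\}\ge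 p_n$; and that $\delta_n^3p_n\gtrsim n^{-1/3}(\log n)^2$ holds while $n^{-1/3}(\log n)^2\gtrsim\delta_n^3p_n$ does not. Assume further that there are constants $\theta>0$, $\eta^2>0$ and $C_1,C_2>0$, not depending on $n$, such that for all $n$ $$|P(X_i>X_j)-\theta|\le C_1n^{-1/6}\log n\quad\text{for all } i\ne j\text{ in }[n],$$ $$\bigl|E\{P(X_j>X_i\mid X_i)\,P(X_k>X_i\mid X_i)\}-\eta^2\bigr|\le C_2n^{-1/3}(\log n)^2\quad\text{for all } i,j,k\in[n],\ j\ne i,\ k\ne i,$$ and that $\eta^2\ne\theta^2$. Given $X_1,\dots,X_n$, let $X_1^*,\dots,X_n^*$ be i.i.d. draws from the empirical distribution of $X_1,\dots,X_n$, let $U_n^{{\rm AP}*}=U_n^{\rm AP}(X_1^*,\dots,X_n^*)$, and let ${\rm Var}^*$ denote the conditional variance given $X_1,\dots,X_n$. Then $\sigma_n>0$ for all sufficiently large $n$, and $$\bigl|{\rm Var}^*(\sigma_n^{-1}U_n^{{\rm AP}*})-{\rm Var}(\sigma_n^{-1}U_n^{\rm AP})\bigr|\to0\quad\text{in probability as }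 n\to\infty.$$ -/

import Mathlib

open MeasureTheory ProbabilityTheory Filter Topology Asymptotics
open scoped ENNReal

noncomputable section

/-- The strict asymptotic order: `b n ≲ a n` holds, but `a n ≲ b n` does not. -/
def StrictlyDominates (a b : ℕ → ℝ) : Prop :=
  b =O[atTop] a ∧ ¬ a =O[atTop] b

/-- The weight of the AP correlation.  The index `i : Fin n` stands for the `(i + 1)`-st observation,
so that `n 𝟙(j < i) / (i - 1)` in one-based indices becomes `n 𝟙(j < i) / i` here. -/
def apWeight (n : ℕ) (i j : Fin n) : ℝ :=
  if j < i then (n : ℝ) / (i : ℝ) else 0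

/-- The AP correlation
`U_n^AP(x₁, …, xₙ) = 1 / (n (n - 1)) * ∑_{i ≠ j} n 𝟙(j < i) / (i - 1) * 𝟙(x_j > x_i)`. -/
def apU (n : ℕ) (x : Fin n → ℝ) : ℝ :=
  1 / ((n : ℝ) * ((n : ℝ) - 1)) *
    ∑ i : Fin n, ∑ j : Fin n,
      if i ≠ j then apWeight n i j * (if x j > x i then 1 else 0) else 0

/-- The empirical distribution `n⁻¹ ∑ δ_{x_i}` of the points `x₁, …, xₙ`. -/
def empiricalMeasure {n : ℕ} (x : Fin n → ℝ) : Measure ℝ :=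
  (n : ℝ≥0∞)⁻¹ • ∑ i : Fin n, Measure.dirac (x i)

/-- The conditional law of the bootstrap sample `(X₁*, …, Xₙ*)` given the data `x`: independent
draws from the empirical distribution of `x`. -/
def bootstrapLaw {n : ℕ} (x : Fin n → ℝ) : Measure (Fin n → ℝ) :=
  Measure.pi fun _ : Fin n => empiricalMeasure x

/-- `Var*`: the conditional variance, given the data `x`, of the statistic `T` evaluated at the
bootstrap sample. -/
def bootstrapVariance {n : ℕ} (T : (Fin n → ℝ) → ℝ) (x : Fin n → ℝ) : ℝ :=
  variance T (bootstrapLaw x)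

/-- The conditional probability `P(Y > Z ∣ Z)`, as a random variable. -/
def condProbGT {Ω : Type*} [MeasurableSpace Ω] (μ : Measure Ω) (Y Z : Ω → ℝ) : Ω → ℝ :=
  μ⟦{ω | Y ω > Z ω} | MeasurableSpace.comap Z inferInstance⟧

/-- The statistic `U_n^AP` as a random variable. -/
def apStat {Ω : Type*} {n : ℕ} (X : Fin n → Ω → ℝ) : Ω → ℝ :=
  fun ω => apU n fun i => X i ω

/-- The standard deviation `σ_n` of `U_n^AP`. -/
def apSigma {Ω : Type*} [MeasurableSpace Ω] {n : ℕ} (μ : Measure Ω) (X : Fin n → Ω → ℝ) : ℝ :=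
  Real.sqrt (variance (apStat X) μ)

end

/-! The approximations pin down the constants. There are no ties, so P(X_i > X_j) + P(X_j > X_i) =
1, and exactly one of three observations is the smallest. Since θ and η² do not depend on n and the
errors vanish, θ = 1/2 and η² = 1/3. To leading order the array thus has the order probabilities of
an i.i.d. continuous sample.

With zero-based indices, (n - 1) U is the sum over i of the row averages i⁻¹ ∑_{j < i} h_ij, where
h_ij = 1(X_j > X_i). Let τ be the approximate covariance of h_ij and h_ik. Reversing an indicator
changes the sign of a covariance, so in two different rows the pairs with a common larger index
cancel against the chains. Each row has variance close to τ, and (n - 1)² Var U = τ n + o(n)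
(`abs_sum_rows_sub_le`, `abs_variance_apStat_sub_le`). Here τ = 1/3 - 1/4 = 1/12.

The same estimate applies to the bootstrap sample: it is i.i.d., and for distinct data two draws tie
with probability at most 1/n. Both variances are therefore asymptotic to 1/(12 n), with a
deterministic error bound on the almost sure event that the data are distinct. -/

/-- The indicator of `X_j > X_i`. -/
noncomputable def exceed {Ω : Type*} {n : ℕ} (Y : Fin n → Ω → ℝ) (i j : Fin n) (ω : Ω) : ℝ :=
  if Y j ω > Y i ω then 1 else 0

/-! ### Cancellation in sums of row covariances -/

section Combinatorics

variable {n : ℕ}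

lemma sum_Iio_const (i : Fin n) (c : ℝ) : ∑ _j ∈ Finset.Iio i, c = (i : ℝ) * c := by
  simp

lemma inv_mul_self_le_one (x : ℝ) : x⁻¹ * x ≤ 1 := by
  by_cases hx : x = 0
  · simp [hx]
  · simp [hx]

/-- Covariances of the weighted rows `i⁻¹ ∑_{j < i} h_{ij}` when the covariances `c i j k l` of
`h_{ij}` and `h_{kl}` vanish for disjoint pairs: off-diagonal rows. -/
lemma abs_row_offdiag_le {c : Fin n → Fin n → Fin n → Fin n → ℝ} {τ ε : ℝ} (hε : 0 ≤ ε)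
    (hdisj : ∀ i j k l, i ≠ k → i ≠ l → j ≠ k → j ≠ l → c i j k l = 0)
    (hmax : ∀ i k l, l < k → k < i → |c i l k l - τ| ≤ ε)
    (hchain : ∀ i k l, l < k → k < i → |c i k k l + τ| ≤ ε) {i k : Fin n} (hki : k < i) :
    |(i : ℝ)⁻¹ * (k : ℝ)⁻¹ * ∑ j ∈ Finset.Iio i, ∑ l ∈ Finset.Iio k, c i j k l|
      ≤ 2 * ε * (i : ℝ)⁻¹ := by
  have hl : ∀ l ∈ Finset.Iio k, |∑ j ∈ Finset.Iio i, c i j k l| ≤ 2 * ε := by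
    intro l hl
    rw [Finset.mem_Iio] at hl
    have hsub : ({l, k} : Finset (Fin n)) ⊆ Finset.Iio i := by
      intro j hj
      simp only [Finset.mem_insert, Finset.mem_singleton] at hj
      rcases hj with rfl | rfl
      · exact Finset.mem_Iio.2 (hl.trans hki)
      · exact Finset.mem_Iio.2 hki
    -- For fixed l, only j = l (common larger index, about τ) and j = k (chain, about -τ) share an
    -- index with (k, l); the two cancel up to 2ε.
    rw [← Finset.sum_subset hsub, Finset.sum_pair hl.ne]
    · have h1 := abs_le.1 (hmax i k l hl hki)
      have h2 := abs_le.1 (hchain i k l hl hki)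
      exact abs_le.2 ⟨by linarith, by linarith⟩
    · intro j _ hj
      simp only [Finset.mem_insert, Finset.mem_singleton, not_or] at hj
      exact hdisj i j k l hki.ne' (hl.trans hki).ne' hj.2 hj.1
  rw [Finset.sum_comm, abs_mul, abs_of_nonneg (by positivity)]
  have h3 : |∑ l ∈ Finset.Iio k, ∑ j ∈ Finset.Iio i, c i j k l| ≤ (k : ℝ) * (2 * ε) := by
    rw [← sum_Iio_const]
    exact (Finset.abs_sum_le_sum_abs _ _).trans (Finset.sum_le_sum hl)
  calc (i : ℝ)⁻¹ * (k : ℝ)⁻¹ * |∑ l ∈ Finset.Iio k, ∑ j ∈ Finset.Iio i, c i j k l|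
      ≤ (i : ℝ)⁻¹ * (k : ℝ)⁻¹ * ((k : ℝ) * (2 * ε)) := by gcongr
    _ = ((k : ℝ)⁻¹ * k) * (2 * ε * (i : ℝ)⁻¹) := by ring
    _ ≤ 1 * (2 * ε * (i : ℝ)⁻¹) := by
        gcongr
        exact inv_mul_self_le_one _
    _ = _ := one_mul _

/-- Covariances of the weighted rows: diagonal terms. -/
lemma abs_row_diag_sub_le {c : Fin n → Fin n → Fin n → Fin n → ℝ} {τ ε : ℝ} (hε : 0 ≤ ε)
    (hmin : ∀ i j l, j < i → l < i → j ≠ l → |c i j i l - τ| ≤ ε)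
    (hself : ∀ i j, |c i j i j - τ| ≤ 2) {i : Fin n} (hi : (i : ℝ) ≠ 0) :
    |(i : ℝ)⁻¹ * (i : ℝ)⁻¹ * ∑ j ∈ Finset.Iio i, ∑ l ∈ Finset.Iio i, c i j i l - τ|
      ≤ ε + 2 * (i : ℝ)⁻¹ := by
  have hj : ∀ j ∈ Finset.Iio i, |∑ l ∈ Finset.Iio i, (c i j i l - τ)| ≤ (i : ℝ) * ε + 2 := by
    intro j hj
    refine (Finset.abs_sum_le_sum_abs _ _).trans ?_
    calc ∑ l ∈ Finset.Iio i, |c i j i l - τ|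
        -- The coincidence l = j is one term among i, so the crude bound 2 costs only 2/i after
        -- averaging.
        ≤ ∑ l ∈ Finset.Iio i, (ε + if j = l then 2 else 0) := by
          refine Finset.sum_le_sum fun l hl => ?_
          split_ifs with h
          · subst h
            linarith [hself i j]
          · simpa using hmin i j l (Finset.mem_Iio.1 hj) (Finset.mem_Iio.1 hl) h
      _ = (i : ℝ) * ε + 2 := by
          rw [Finset.sum_add_distrib, sum_Iio_const, Finset.sum_ite_eq, if_pos hj]
  have h1 : (i : ℝ)⁻¹ * (i : ℝ)⁻¹ * ∑ j ∈ Finset.Iio i, ∑ l ∈ Finset.Iio i, c i j i l - τ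
      = (i : ℝ)⁻¹ * (i : ℝ)⁻¹ * ∑ j ∈ Finset.Iio i, ∑ l ∈ Finset.Iio i, (c i j i l - τ) := by
    simp_rw [Finset.sum_sub_distrib, sum_Iio_const]
    field_simp
  rw [h1, abs_mul, abs_of_nonneg (by positivity)]
  have h2 : |∑ j ∈ Finset.Iio i, ∑ l ∈ Finset.Iio i, (c i j i l - τ)|
      ≤ (i : ℝ) * ((i : ℝ) * ε + 2) := by
    rw [← sum_Iio_const]
    exact (Finset.abs_sum_le_sum_abs _ _).trans (Finset.sum_le_sum hj)
  calc (i : ℝ)⁻¹ * (i : ℝ)⁻¹ * |∑ j ∈ Finset.Iio i, ∑ l ∈ Finset.Iio i, (c i j i l - τ)|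
      ≤ (i : ℝ)⁻¹ * (i : ℝ)⁻¹ * ((i : ℝ) * ((i : ℝ) * ε + 2)) := by gcongr
    _ = _ := by field_simp

lemma sum_ite_lt_le {ε : ℝ} (hε : 0 ≤ ε) :
    ∑ i : Fin n, ∑ k : Fin n, (if k < i then 2 * ε * (i : ℝ)⁻¹ else 0) ≤ 2 * ε * n := by
  have h : ∀ i : Fin n, ∑ k : Fin n, (if k < i then 2 * ε * (i : ℝ)⁻¹ else 0) ≤ 2 * ε := by
    intro i
    rw [← Finset.sum_filter, show Finset.univ.filter (· < i) = Finset.Iio i by ext; simp,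
      sum_Iio_const]
    calc (i : ℝ) * (2 * ε * (i : ℝ)⁻¹) = ((i : ℝ)⁻¹ * i) * (2 * ε) := by ring
      _ ≤ 1 * (2 * ε) := by
        gcongr
        exact inv_mul_self_le_one _
      _ = _ := one_mul _
  refine (Finset.sum_le_sum fun i _ => h i).trans (le_of_eq ?_)
  simp
  ring

/-- The sum of the covariances of all weighted rows is `τ n` up to an error. -/
lemma abs_sum_rows_sub_le {c : Fin n → Fin n → Fin n → Fin n → ℝ} {τ ε : ℝ} (hε : 0 ≤ ε)
    (hτ : |τ| ≤ 1)
    (hsymm : ∀ i j k l, c i j k l = c k l i j)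
    (hdisj : ∀ i j k l, i ≠ k → i ≠ l → j ≠ k → j ≠ l → c i j k l = 0)
    (hmax : ∀ i k l, l < k → k < i → |c i l k l - τ| ≤ ε)
    (hchain : ∀ i k l, l < k → k < i → |c i k k l + τ| ≤ ε)
    (hmin : ∀ i j l, j < i → l < i → j ≠ l → |c i j i l - τ| ≤ ε)
    (hself : ∀ i j, |c i j i j - τ| ≤ 2) :
    |∑ i : Fin n, ∑ k : Fin n,
        (i : ℝ)⁻¹ * (k : ℝ)⁻¹ * ∑ j ∈ Finset.Iio i, ∑ l ∈ Finset.Iio k, c i j k l - τ * n|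
      ≤ 5 * ε * n + 2 * ∑ i : Fin n, (i : ℝ)⁻¹ + 1 := by
  set D : Fin n → Fin n → ℝ := fun i k =>
    (i : ℝ)⁻¹ * (k : ℝ)⁻¹ * ∑ j ∈ Finset.Iio i, ∑ l ∈ Finset.Iio k, c i j k l with hD
  have hDs : ∀ i k, D i k = D k i := by
    intro i k
    simp only [hD]
    rw [Finset.sum_comm, mul_comm (i : ℝ)⁻¹]
    simp_rw [hsymm i _ k]
  have hoff : ∀ i k, k < i → |D i k| ≤ 2 * ε * (i : ℝ)⁻¹ := fun i k h =>
    abs_row_offdiag_le hε hdisj hmax hchain h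
  have hterm : ∀ i k, |D i k - if i = k then τ else 0| ≤
      (if i = k then ε + 2 * (i : ℝ)⁻¹ + (if (i : ℕ) = 0 then 1 else 0) else 0)
      + (if k < i then 2 * ε * (i : ℝ)⁻¹ else 0) + (if i < k then 2 * ε * (k : ℝ)⁻¹ else 0) := by
    intro i k
    rcases lt_trichotomy i k with h | rfl | h
    · simpa [h, h.ne, h.not_gt, hDs i k] using hoff k i h
    -- Row 0 is empty and has weight 0⁻¹ = 0: its entry is 0 instead of τ. This is the final `+ 1`
    -- in the bound.
    · by_cases h0 : (i : ℕ) = 0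
      · simp [hD, h0]
        linarith
      · have := abs_row_diag_sub_le hε hmin hself (i := i) (by exact_mod_cast h0)
        simpa [h0, hD] using this
    · simpa [h, h.ne', h.not_gt] using hoff i k h
  have hone : ∑ i : Fin n, (if (i : ℕ) = 0 then (1 : ℝ) else 0) ≤ 1 := by
    rw [Fin.sum_univ_eq_sum_range (fun i => if i = 0 then (1 : ℝ) else 0), Finset.sum_ite_eq']
    split_ifs <;> norm_num
  have hrw : ∑ i, ∑ k, D i k - τ * n = ∑ i, ∑ k, (D i k - if i = k then τ else 0) := by
    simp [Finset.sum_sub_distrib, mul_comm]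
  rw [hrw]
  calc |∑ i, ∑ k, (D i k - if i = k then τ else 0)|
      ≤ ∑ i, ∑ k, |D i k - if i = k then τ else 0| :=
        (Finset.abs_sum_le_sum_abs _ _).trans
          (Finset.sum_le_sum fun i _ => Finset.abs_sum_le_sum_abs _ _)
    _ ≤ _ := Finset.sum_le_sum fun i _ => Finset.sum_le_sum fun k _ => hterm i k
    _ = (n * ε + 2 * ∑ i : Fin n, (i : ℝ)⁻¹ + ∑ i : Fin n, (if (i : ℕ) = 0 then (1 : ℝ) else 0))
        + ∑ i : Fin n, ∑ k : Fin n, (if k < i then 2 * ε * (i : ℝ)⁻¹ else 0)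
        + ∑ i : Fin n, ∑ k : Fin n, (if k < i then 2 * ε * (i : ℝ)⁻¹ else 0) := by
        simp_rw [Finset.sum_add_distrib]
        congr 1
        · simp [Finset.sum_add_distrib, Finset.mul_sum]
        · exact Finset.sum_comm
    _ ≤ _ := by linarith [sum_ite_lt_le (n := n) hε]

end Combinatorics

/-! ### Variance of the statistic from covariances of order indicators -/

section Variance

variable {Ω : Type*} [MeasurableSpace Ω] {μ : Measure Ω} [IsProbabilityMeasure μ]

lemma memLp_two_of_unit {f : Ω → ℝ} (hf : Measurable f) (h : ∀ ω, f ω ∈ Set.Icc (0 : ℝ) 1) :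
    MemLp f 2 μ :=
  MemLp.of_bound hf.aestronglyMeasurable 1 (ae_of_all _ fun ω => by
    rw [Real.norm_eq_abs, abs_of_nonneg (h ω).1]
    exact (h ω).2)

lemma integral_mem_unit {f : Ω → ℝ} (hf : Measurable f) (h : ∀ ω, f ω ∈ Set.Icc (0 : ℝ) 1) :
    ∫ ω, f ω ∂μ ∈ Set.Icc (0 : ℝ) 1 := by
  refine ⟨integral_nonneg fun ω => (h ω).1, ?_⟩
  have := integral_mono ((memLp_two_of_unit (μ := μ) hf h).integrable one_le_two)
    (integrable_const (1 : ℝ)) fun ω => (h ω).2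
  simpa using this

/-- Both E[TZ] and E[T] E[Z] lie in [0, E[T]]. Applied to a tie indicator T, this makes ties
negligible in every covariance. -/
lemma abs_covariance_le_integral {T Z : Ω → ℝ} (hT : Measurable T) (hZ : Measurable Z)
    (hT1 : ∀ ω, T ω ∈ Set.Icc (0 : ℝ) 1) (hZ1 : ∀ ω, Z ω ∈ Set.Icc (0 : ℝ) 1) :
    |cov[T, Z; μ]| ≤ ∫ ω, T ω ∂μ := by
  have hTZ : ∀ ω, (T * Z) ω ∈ Set.Icc (0 : ℝ) 1 := fun ω =>
    ⟨mul_nonneg (hT1 ω).1 (hZ1 ω).1, mul_le_one₀ (hT1 ω).2 (hZ1 ω).1 (hZ1 ω).2⟩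
  rw [covariance_eq_sub (memLp_two_of_unit hT hT1) (memLp_two_of_unit hZ hZ1)]
  have h1 := integral_mem_unit (μ := μ) hT hT1
  have h2 := integral_mem_unit (μ := μ) hZ hZ1
  have h3 : ∫ ω, (T * Z) ω ∂μ ≤ ∫ ω, T ω ∂μ :=
    integral_mono ((memLp_two_of_unit (hT.mul hZ) hTZ).integrable one_le_two)
      ((memLp_two_of_unit hT hT1).integrable one_le_two)
      fun ω => mul_le_of_le_one_right (hT1 ω).1 (hZ1 ω).2
  have h4 : 0 ≤ ∫ ω, (T * Z) ω ∂μ := integral_nonneg fun ω => (hTZ ω).1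
  have h5 := mul_le_of_le_one_right h1.1 h2.2
  have h6 := mul_nonneg h1.1 h2.1
  exact abs_le.2 ⟨by linarith, by linarith⟩

variable {n : ℕ} {Y : Fin n → Ω → ℝ}

lemma measurable_exceed (hY : ∀ i, Measurable (Y i)) (i j : Fin n) : Measurable (exceed Y i j) :=
  Measurable.ite (measurableSet_lt (hY i) (hY j)) measurable_const measurable_const

omit [MeasurableSpace Ω] in
lemma exceed_mem (i j : Fin n) (ω : Ω) : exceed Y i j ω ∈ Set.Icc (0 : ℝ) 1 := by
  unfold exceed
  split_ifs <;> simp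

lemma memLp_exceed (hY : ∀ i, Measurable (Y i)) (i j : Fin n) : MemLp (exceed Y i j) 2 μ :=
  memLp_two_of_unit (measurable_exceed hY i j) (exceed_mem i j)

/-- Up to ties, `1(X_j > X_i) = 1 - 1(X_i > X_j)`. -/
lemma abs_covariance_exceed_add_le (hY : ∀ i, Measurable (Y i)) {i j : Fin n} {ε : ℝ}
    (htie : μ.real {ω | Y i ω = Y j ω} ≤ ε) {Z : Ω → ℝ} (hZ : Measurable Z)
    (hZ1 : ∀ ω, Z ω ∈ Set.Icc (0 : ℝ) 1) :
    |cov[exceed Y i j, Z; μ] + cov[exceed Y j i, Z; μ]| ≤ ε := by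
  have hms : MeasurableSet {ω | Y i ω = Y j ω} := measurableSet_eq_fun (hY i) (hY j)
  set T : Ω → ℝ := Set.indicator {ω | Y i ω = Y j ω} 1 with hT
  have hTm : Measurable T := measurable_one.indicator hms
  have hT1 : ∀ ω, T ω ∈ Set.Icc (0 : ℝ) 1 := fun ω => by
    simp only [hT, Set.indicator]
    split_ifs <;> simp
  have hsum : exceed Y i j + exceed Y j i = fun ω => 1 - T ω := by
    funext ω
    simp only [Pi.add_apply, exceed, hT, Set.indicator, Set.mem_ofPred_eq, Pi.one_apply]
    rcases lt_trichotomy (Y i ω) (Y j ω) with h | h | h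
    · simp [h, h.ne, h.not_gt]
    · simp [h]
    · simp [h, h.ne', h.not_gt]
  rw [← covariance_add_left (memLp_exceed hY i j) (memLp_exceed hY j i)
    (memLp_two_of_unit hZ hZ1), hsum,
    covariance_const_sub_left ((memLp_two_of_unit hTm hT1).integrable one_le_two), abs_neg]
  refine (abs_covariance_le_integral hTm hZ hT1 hZ1).trans ?_
  rw [hT, integral_indicator_one hms]
  exact htie

-- The factor n of the weight cancels the one in the normalization, leaving a sum of row averages.
omit [MeasurableSpace Ω] in
lemma apStat_eq : apStat Y = fun ω => ((n : ℝ) - 1)⁻¹ *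
    ∑ i : Fin n, (i : ℝ)⁻¹ * ∑ j ∈ Finset.Iio i, exceed Y i j ω := by
  funext ω
  rcases Nat.eq_zero_or_pos n with rfl | hn
  · simp [apStat, apU]
  have hn' : (n : ℝ) ≠ 0 := by positivity
  simp only [apStat, apU, Finset.mul_sum]
  refine Finset.sum_congr rfl fun i _ => ?_
  rw [show Finset.Iio i = Finset.univ.filter (· < i) by ext; simp, Finset.sum_filter]
  refine Finset.sum_congr rfl fun j _ => ?_
  by_cases h : j < i
  · simp only [apWeight, h, h.ne', exceed, if_true, ne_eq, not_false_eq_true]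
    rw [one_div, mul_inv, div_eq_mul_inv]
    field_simp
  · simp [apWeight, h]

lemma variance_apStat (hY : ∀ i, Measurable (Y i)) :
    Var[apStat Y; μ] = (((n : ℝ) - 1)⁻¹) ^ 2 * ∑ i : Fin n, ∑ k : Fin n,
      (i : ℝ)⁻¹ * (k : ℝ)⁻¹ * ∑ j ∈ Finset.Iio i, ∑ l ∈ Finset.Iio k,
        cov[exceed Y i j, exceed Y k l; μ] := by
  have hrow : ∀ i : Fin n, MemLp (fun ω => ∑ j ∈ Finset.Iio i, exceed Y i j ω) 2 μ := fun i =>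
    memLp_finsetSum _ fun j _ => memLp_exceed hY i j
  rw [apStat_eq, variance_const_mul, variance_fun_sum fun i => (hrow i).const_mul _]
  congr 1
  refine Finset.sum_congr rfl fun i _ => Finset.sum_congr rfl fun k _ => ?_
  rw [covariance_const_mul_left, covariance_const_mul_right,
    covariance_fun_sum_fun_sum' (fun j _ => memLp_exceed hY i j) (fun l _ => memLp_exceed hY k l)]
  ring

/-- The variance of `U^AP` for independent observations that are nearly exchangeable, up to second
order, with few ties. -/
theorem abs_variance_apStat_sub_le (hn : 2 ≤ n) (hY : ∀ i, Measurable (Y i)) (hind : iIndepFun Y μ)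
    {τ ε : ℝ} (hε : 0 ≤ ε) (hτ : |τ| ≤ 1)
    (htie : ∀ i j, i ≠ j → μ.real {ω | Y i ω = Y j ω} ≤ ε)
    (hmin : ∀ i j k, i ≠ j → i ≠ k → j ≠ k → |cov[exceed Y i j, exceed Y i k; μ] - τ| ≤ ε) :
    |((n : ℝ) - 1) ^ 2 * Var[apStat Y; μ] - τ * n|
      ≤ 15 * ε * n + 2 * ∑ i : Fin n, (i : ℝ)⁻¹ + 1 := by
  have hn1 : ((n : ℝ) - 1) ≠ 0 := by
    have : (2 : ℝ) ≤ n := by exact_mod_cast hn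
    linarith
  rw [variance_apStat hY, ← mul_assoc, ← mul_pow, mul_inv_cancel₀ hn1, one_pow, one_mul]
  have hanti : ∀ i j k l, i ≠ j →
      |cov[exceed Y i j, exceed Y k l; μ] + cov[exceed Y j i, exceed Y k l; μ]| ≤ ε :=
    fun i j k l h => abs_covariance_exceed_add_le hY (htie i j h) (measurable_exceed hY k l)
      (exceed_mem k l)
  -- The factor 3 covers the worst case: two reversals, each costing the tie bound ε, and one use of
  -- `hmin`.
  have key := abs_sum_rows_sub_le (n := n) (τ := τ) (ε := 3 * ε)
    (c := fun i j k l => cov[exceed Y i j, exceed Y k l; μ]) (by positivity) hτ ?_ ?_ ?_ ?_ ?_ ?_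
  · convert key using 3
    ring
  · intro i j k l
    exact covariance_comm _ _
  · intro i j k l hik hil hjk hjl
    refine IndepFun.covariance_eq_zero ?_ (memLp_exceed hY i j) (memLp_exceed hY k l)
    have hm : Measurable fun q : ℝ × ℝ => if q.2 > q.1 then (1 : ℝ) else 0 :=
      Measurable.ite (measurableSet_lt measurable_fst measurable_snd) measurable_const
        measurable_const
    exact (hind.indepFun_prodMk_prodMk hY i j k l hik hil hjk hjl).comp hm hm
  -- A common larger index l becomes a common smaller one when both indicators are reversed, so the
  -- sign changes twice.
  · intro i k l hlk hki
    have h1 := abs_le.1 (hanti i l k l (hlk.trans hki).ne')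
    have h2 := abs_le.1 (hanti k l l i hlk.ne')
    have h3 := abs_le.1 (hmin l k i hlk.ne (hlk.trans hki).ne hki.ne)
    have h4 := covariance_comm (μ := μ) (exceed Y l i) (exceed Y k l)
    exact abs_le.2 ⟨by linarith, by linarith⟩
  -- In a chain one reversal suffices, so the sign changes once.
  · intro i k l hlk hki
    have h1 := abs_le.1 (hanti i k k l hki.ne')
    have h3 := abs_le.1 (hmin k i l hki.ne hlk.ne' (hlk.trans hki).ne')
    exact abs_le.2 ⟨by linarith, by linarith⟩
  · intro i j l hj hl hjl
    exact (hmin i j l hj.ne' hl.ne' hjl).trans (by linarith)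
  · intro i j
    have h1 := (abs_covariance_le_integral (μ := μ) (measurable_exceed hY i j)
      (measurable_exceed hY i j) (exceed_mem i j) (exceed_mem i j)).trans
      (integral_mem_unit (measurable_exceed hY i j) (exceed_mem i j)).2
    exact (abs_sub _ _).trans (by linarith)

end Variance

/-! ### Order patterns of two and three observations -/

section Patterns

variable {Ω : Type*} [MeasurableSpace Ω] {μ : Measure Ω} [IsProbabilityMeasure μ]
  {n : ℕ} {Y : Fin n → Ω → ℝ}

lemma integrable_exceed (hY : ∀ i, Measurable (Y i)) (i j : Fin n) : Integrable (exceed Y i j) μ :=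
  (memLp_exceed hY i j).integrable one_le_two

lemma integrable_exceed_mul (hY : ∀ i, Measurable (Y i)) (i j k l : Fin n) :
    Integrable (fun ω => exceed Y i j ω * exceed Y k l ω) μ :=
  (memLp_exceed hY i j).integrable_mul (memLp_exceed hY k l)

omit [IsProbabilityMeasure μ] in
lemma integral_exceed (hY : ∀ i, Measurable (Y i)) (i j : Fin n) :
    ∫ ω, exceed Y i j ω ∂μ = μ.real {ω | Y j ω > Y i ω} := by
  rw [← integral_indicator_one (measurableSet_lt (hY i) (hY j))]
  rfl

lemma abs_integral_sub_one_le {f T : Ω → ℝ} {c : ℝ} (hf : Integrable f μ) (hT : Integrable T μ)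
    (h : ∀ ω, |f ω - 1| ≤ T ω) (hc : ∫ ω, T ω ∂μ ≤ c) : |∫ ω, f ω ∂μ - 1| ≤ c := by
  have h1 : ∫ ω, f ω ∂μ - 1 = ∫ ω, (f ω - 1) ∂μ := by
    rw [integral_sub hf (integrable_const _)]
    simp
  rw [h1]
  refine (abs_integral_le_integral_abs).trans (le_trans ?_ hc)
  exact integral_mono (hf.sub (integrable_const _)).abs hT h

lemma integrable_tie (hY : ∀ i, Measurable (Y i)) (i j : Fin n) :
    Integrable (Set.indicator {ω | Y i ω = Y j ω} (1 : Ω → ℝ)) μ :=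
  (integrable_const (1 : ℝ)).indicator (measurableSet_eq_fun (hY i) (hY j))

omit [IsProbabilityMeasure μ] in
lemma integral_tie (hY : ∀ i, Measurable (Y i)) (i j : Fin n) :
    ∫ ω, Set.indicator {ω | Y i ω = Y j ω} (1 : Ω → ℝ) ω ∂μ = μ.real {ω | Y i ω = Y j ω} :=
  integral_indicator_one (measurableSet_eq_fun (hY i) (hY j))

/-- Up to ties, one of two observations is the smaller one. -/
lemma abs_integral_exceed_add_sub_one_le (hY : ∀ i, Measurable (Y i)) {i j : Fin n} {ε : ℝ}
    (htie : μ.real {ω | Y i ω = Y j ω} ≤ ε) :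
    |∫ ω, exceed Y i j ω ∂μ + ∫ ω, exceed Y j i ω ∂μ - 1| ≤ ε := by
  rw [← integral_add (integrable_exceed hY i j) (integrable_exceed hY j i)]
  refine abs_integral_sub_one_le ((integrable_exceed hY i j).add (integrable_exceed hY j i))
    (integrable_tie hY i j) (fun ω => ?_) ((integral_tie hY i j).trans_le htie)
  simp only [exceed, Set.indicator, Set.mem_ofPred_eq, Pi.one_apply]
  rcases lt_trichotomy (Y i ω) (Y j ω) with h | h | h
  · simp [h, h.ne, h.not_gt]
  · simp [h]
  · simp [h, h.ne', h.not_gt]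

/-- Up to ties, one of three observations is the smallest one. -/
lemma abs_integral_exceed_mul_add_sub_one_le (hY : ∀ i, Measurable (Y i)) {i j k : Fin n} {ε : ℝ}
    (hij : μ.real {ω | Y i ω = Y j ω} ≤ ε) (hik : μ.real {ω | Y i ω = Y k ω} ≤ ε)
    (hjk : μ.real {ω | Y j ω = Y k ω} ≤ ε) :
    |∫ ω, exceed Y i j ω * exceed Y i k ω ∂μ + ∫ ω, exceed Y j i ω * exceed Y j k ω ∂μ
      + ∫ ω, exceed Y k i ω * exceed Y k j ω ∂μ - 1| ≤ 3 * ε := by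
  have I1 := integrable_exceed_mul (μ := μ) hY i j i k
  have I2 := integrable_exceed_mul (μ := μ) hY j i j k
  have I3 := integrable_exceed_mul (μ := μ) hY k i k j
  have T1 := integrable_tie (μ := μ) hY i j
  have T2 := integrable_tie (μ := μ) hY i k
  have T3 := integrable_tie (μ := μ) hY j k
  rw [← integral_add' I1 I2, ← integral_add' (I1.add I2) I3]
  refine abs_integral_sub_one_le ((I1.add I2).add I3) ((T1.add T2).add T3) (fun ω => ?_) ?_
  · simp only [exceed, Set.indicator, Set.mem_ofPred_eq, Pi.one_apply, Pi.add_apply]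
    -- Of the 27 sign patterns the inconsistent ones are discarded; without ties exactly one product
    -- is 1, and otherwise a tie indicator absorbs the error.
    rcases lt_trichotomy (Y i ω) (Y j ω) with h | h | h <;>
    rcases lt_trichotomy (Y i ω) (Y k ω) with h' | h' | h' <;>
    rcases lt_trichotomy (Y j ω) (Y k ω) with h'' | h'' | h'' <;>
    first
    | (exfalso; linarith)
    | simp [h, h', h'', h.ne, h.ne', h.not_gt, h'.ne, h'.ne', h'.not_gt, h''.ne, h''.ne', h''.not_gt]
    | simp_all [not_lt_of_gt, ne_of_lt, ne_of_gt]
  · rw [integral_add' (T1.add T2) T3, integral_add' T1 T2, integral_tie hY, integral_tie hY,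
      integral_tie hY]
    linarith

/-- Here 1/12 = 1/3 - (1/2)², and pq - 1/4 = (p - 1/2) q + (q - 1/2)/2 with q in [0, 1]. -/
lemma abs_covariance_exceed_sub_le (hY : ∀ i, Measurable (Y i)) {i j k : Fin n} {ε : ℝ}
    (hij : |∫ ω, exceed Y i j ω ∂μ - 1 / 2| ≤ ε) (hik : |∫ ω, exceed Y i k ω ∂μ - 1 / 2| ≤ ε)
    (hijk : |∫ ω, exceed Y i j ω * exceed Y i k ω ∂μ - 1 / 3| ≤ ε) :
    |cov[exceed Y i j, exceed Y i k; μ] - 1 / 12| ≤ 3 * ε := by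
  rw [covariance_eq_sub (memLp_exceed hY i j) (memLp_exceed hY i k)]
  change |∫ ω, exceed Y i j ω * exceed Y i k ω ∂μ - _ - 1 / 12| ≤ _
  have hq := integral_mem_unit (μ := μ) (measurable_exceed hY i k) (exceed_mem i k)
  set p := ∫ ω, exceed Y i j ω ∂μ
  set q := ∫ ω, exceed Y i k ω ∂μ
  set m := ∫ ω, exceed Y i j ω * exceed Y i k ω ∂μ
  have h1 : |(p - 1 / 2) * q| ≤ ε := by
    rw [abs_mul, abs_of_nonneg hq.1]
    exact (mul_le_of_le_one_right (abs_nonneg _) hq.2).trans hij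
  have h2 := abs_le.1 h1
  have h3 := abs_le.1 hik
  have h4 := abs_le.1 hijk
  exact abs_le.2 ⟨by linarith, by linarith⟩

end Patterns

/-- By Fubini, each slice of the diagonal is a single atom of the law of Z. The bound serves with c
= 1/n for the bootstrap and c = 0 for the array. -/
lemma measure_tie_le {Ω : Type*} [MeasurableSpace Ω] {μ : Measure Ω} [IsProbabilityMeasure μ]
    {Y Z : Ω → ℝ} (hY : Measurable Y) (hZ : Measurable Z) (h : IndepFun Y Z μ) {c : ℝ≥0∞}
    (hc : ∀ y, μ.map Z {y} ≤ c) : μ {ω | Y ω = Z ω} ≤ c := by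
  have : IsProbabilityMeasure (μ.map Y) := Measure.isProbabilityMeasure_map hY.aemeasurable
  have : IsProbabilityMeasure (μ.map Z) := Measure.isProbabilityMeasure_map hZ.aemeasurable
  have hms : MeasurableSet {q : ℝ × ℝ | q.1 = q.2} :=
    measurableSet_eq_fun measurable_fst measurable_snd
  have h1 : μ {ω | Y ω = Z ω} = μ.map (fun ω => (Y ω, Z ω)) {q : ℝ × ℝ | q.1 = q.2} := by
    rw [Measure.map_apply (hY.prodMk hZ) hms]
    rfl
  rw [h1, (indepFun_iff_map_prod_eq_prod_map_map hY.aemeasurable hZ.aemeasurable).1 h,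
    Measure.prod_apply hms]
  calc ∫⁻ y, μ.map Z (Prod.mk y ⁻¹' {q : ℝ × ℝ | q.1 = q.2}) ∂(μ.map Y)
      ≤ ∫⁻ _, c ∂(μ.map Y) := by
        refine lintegral_mono fun y => ?_
        rw [show Prod.mk y ⁻¹' {q : ℝ × ℝ | q.1 = q.2} = {y} by ext; simp [eq_comm]]
        exact hc y
    _ = c := by simp

/-! ### Bootstrap variance for distinct data -/

section Bootstrap

variable {n : ℕ}

lemma isProbabilityMeasure_empiricalMeasure (hn : n ≠ 0) (x : Fin n → ℝ) :
    IsProbabilityMeasure (empiricalMeasure x) := by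
  constructor
  simp [empiricalMeasure, ENNReal.inv_mul_cancel, hn]

lemma empiricalMeasure_singleton_le {x : Fin n → ℝ} (hx : Function.Injective x) (y : ℝ) :
    empiricalMeasure x {y} ≤ (n : ℝ≥0∞)⁻¹ := by
  have h : ∑ i : Fin n, Measure.dirac (x i) {y} ≤ 1 := by
    simp only [Measure.dirac_apply, Set.indicator, Set.mem_singleton_iff, Pi.one_apply]
    rw [Finset.sum_boole]
    have : (Finset.univ.filter fun i => x i = y).card ≤ 1 :=
      Finset.card_le_one.2 fun a ha b hb =>
        hx ((Finset.mem_filter.1 ha).2.trans (Finset.mem_filter.1 hb).2.symm)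
    exact_mod_cast this
  simp only [empiricalMeasure, Measure.smul_apply, Measure.finsetSum_apply, smul_eq_mul]
  exact mul_le_of_le_one_right' h

/-- Exchangeability of i.i.d. coordinates. `piCongrLeft` relabels in the opposite direction, hence
`e.symm`. -/
lemma measurePreserving_comp_perm (ν : Measure ℝ) [SigmaFinite ν] (e : Equiv.Perm (Fin n)) :
    MeasurePreserving (fun (y : Fin n → ℝ) i => y (e i)) (Measure.pi fun _ => ν)
      (Measure.pi fun _ => ν) := by
  convert! measurePreserving_piCongrLeft (fun _ : Fin n => ν) e.symm using 1
  funext y i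
  have := MeasurableEquiv.piCongrLeft_apply_apply (β := fun _ => ℝ) e.symm y (e i)
  simpa using this.symm

lemma integral_pi_comp_perm (ν : Measure ℝ) [SigmaFinite ν] (e : Equiv.Perm (Fin n))
    {f : (Fin n → ℝ) → ℝ} (hf : Measurable f) :
    ∫ y, f (fun i => y (e i)) ∂(Measure.pi fun _ : Fin n => ν)
      = ∫ y, f y ∂(Measure.pi fun _ : Fin n => ν) := by
  have h := measurePreserving_comp_perm ν e
  conv_rhs => rw [← h.map_eq]
  rw [integral_map h.measurable.aemeasurable hf.aestronglyMeasurable]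

/-- For distinct data, the bootstrap variance of `U^AP` is close to `1 / (12 n)`. -/
theorem abs_bootstrapVariance_sub_le (hn : 2 ≤ n) {x : Fin n → ℝ} (hx : Function.Injective x) :
    |((n : ℝ) - 1) ^ 2 * bootstrapVariance (apU n) x - 1 / 12 * n|
      ≤ 2 * ∑ i : Fin n, (i : ℝ)⁻¹ + 46 := by
  have hn0 : n ≠ 0 := by omega
  have hnR : (n : ℝ) ≠ 0 := by exact_mod_cast hn0
  have := isProbabilityMeasure_empiricalMeasure hn0 x
  have hν : bootstrapLaw x = Measure.pi fun _ : Fin n => empiricalMeasure x := rfl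
  have hP : IsProbabilityMeasure (bootstrapLaw x) := by
    rw [hν]
    infer_instance
  set Y : Fin n → (Fin n → ℝ) → ℝ := fun i y => y i with hYdef
  have hY : ∀ i, Measurable (Y i) := fun i => measurable_pi_apply i
  have hind : iIndepFun Y (bootstrapLaw x) :=
    iIndepFun_pi (X := fun _ : Fin n => (id : ℝ → ℝ)) (fun _ => aemeasurable_id)
  have htie : ∀ i j, i ≠ j → (bootstrapLaw x).real {y | Y i y = Y j y} ≤ (n : ℝ)⁻¹ := by
    intro i j hij
    have h1 : bootstrapLaw x {y | Y i y = Y j y} ≤ (n : ℝ≥0∞)⁻¹ := by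
      refine measure_tie_le (hY i) (hY j) (hind.indepFun hij) fun y => ?_
      have : (bootstrapLaw x).map (Y j) = empiricalMeasure x :=
        (measurePreserving_eval (fun _ : Fin n => empiricalMeasure x) j).map_eq
      rw [this]
      exact empiricalMeasure_singleton_le hx y
    have h2 := ENNReal.toReal_mono (by simp [hn0]) h1
    simpa [Measure.real] using h2
  have hpair : ∀ i j, i ≠ j →
      |∫ y, exceed Y i j y ∂(bootstrapLaw x) - 1 / 2| ≤ (n : ℝ)⁻¹ := by
    intro i j hij
    have h1 := abs_le.1 (abs_integral_exceed_add_sub_one_le hY (htie i j hij))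
    -- By exchangeability the two probabilities are equal, and they sum to 1 up to ties; the triples
    -- below work the same way.
    have h2 : ∫ y, exceed Y j i y ∂(bootstrapLaw x) = ∫ y, exceed Y i j y ∂(bootstrapLaw x) := by
      rw [hν, ← integral_pi_comp_perm _ (Equiv.swap i j) (measurable_exceed hY i j)]
      simp [exceed, hYdef]
    have h3 : 0 ≤ (n : ℝ)⁻¹ := by positivity
    exact abs_le.2 ⟨by linarith, by linarith⟩
  have htriple : ∀ i j k, i ≠ j → i ≠ k → j ≠ k →
      |∫ y, exceed Y i j y * exceed Y i k y ∂(bootstrapLaw x) - 1 / 3| ≤ (n : ℝ)⁻¹ := by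
    intro i j k hij hik hjk
    have h1 := abs_le.1 (abs_integral_exceed_mul_add_sub_one_le hY (htie i j hij) (htie i k hik)
      (htie j k hjk))
    have hm : Measurable fun y => exceed Y i j y * exceed Y i k y :=
      (measurable_exceed hY i j).mul (measurable_exceed hY i k)
    have h2 : ∫ y, exceed Y j i y * exceed Y j k y ∂(bootstrapLaw x)
        = ∫ y, exceed Y i j y * exceed Y i k y ∂(bootstrapLaw x) := by
      rw [hν, ← integral_pi_comp_perm _ (Equiv.swap i j) hm]
      simp [exceed, hYdef, Equiv.swap_apply_of_ne_of_ne hik.symm hjk.symm]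
    have h3 : ∫ y, exceed Y k i y * exceed Y k j y ∂(bootstrapLaw x)
        = ∫ y, exceed Y i j y * exceed Y i k y ∂(bootstrapLaw x) := by
      rw [hν, ← integral_pi_comp_perm _ (Equiv.swap i k) hm]
      simp [exceed, hYdef, Equiv.swap_apply_of_ne_of_ne hij.symm hjk, mul_comm]
    exact abs_le.2 ⟨by linarith, by linarith⟩
  -- With ε = 3/n the term 15 ε n equals 45, whence 46 = 45 + 1.
  have key := abs_variance_apStat_sub_le (μ := bootstrapLaw x) (τ := 1 / 12) (ε := 3 * (n : ℝ)⁻¹)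
    hn hY hind (by positivity) (by norm_num [abs_of_pos])
    (fun i j hij => (htie i j hij).trans (by
      have : 0 ≤ (n : ℝ)⁻¹ := by positivity
      linarith))
    (fun i j k hij hik hjk => abs_covariance_exceed_sub_le hY (hpair i j hij) (hpair i k hik)
      (htriple i j k hij hik hjk))
  refine key.trans (le_of_eq ?_)
  field_simp
  ring

end Bootstrap

/-! ### Conditional probabilities under independence -/

section Conditional

variable {Ω : Type*} [MeasurableSpace Ω] {μ : Measure Ω} [IsProbabilityMeasure μ]

/-- By independence the conditional distribution of Y given X is the constant kernel at the law of
Y. -/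
lemma condExp_prod_ae_eq_integral_map {X Y : Ω → ℝ} (hX : Measurable X) (hY : Measurable Y)
    (h : IndepFun X Y μ) {f : ℝ × ℝ → ℝ} (hf : StronglyMeasurable f)
    (hint : Integrable (fun ω => f (X ω, Y ω)) μ) :
    μ[fun ω => f (X ω, Y ω) | MeasurableSpace.comap X inferInstance]
      =ᵐ[μ] fun ω => ∫ y, f (X ω, y) ∂(μ.map Y) := by
  have : IsProbabilityMeasure (μ.map Y) := Measure.isProbabilityMeasure_map hY.aemeasurable
  have hd : condDistrib Y X μ =ᵐ[μ.map X] Kernel.const ℝ (μ.map Y) := by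
    refine condDistrib_ae_eq_of_measure_eq_compProd X hY.aemeasurable ?_
    rw [Measure.compProd_const,
      (indepFun_iff_map_prod_eq_prod_map_map hX.aemeasurable hY.aemeasurable).1 h]
  filter_upwards [condExp_prod_ae_eq_integral_condDistrib hX hY.aemeasurable hf hint,
    ae_of_ae_map hX.aemeasurable hd] with ω h1 h2
  rw [h1, h2, Kernel.const_apply]

/-- By independence, the mixed conditional moment is the probability that `X_i` is the smallest. -/
lemma integral_condProbGT_mul {n : ℕ} {Y : Fin n → Ω → ℝ} (hY : ∀ i, Measurable (Y i))
    (hind : iIndepFun Y μ) {i j k : Fin n} (hij : i ≠ j) (hik : i ≠ k) (hjk : j ≠ k) :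
    ∫ ω, condProbGT μ (Y j) (Y i) ω * condProbGT μ (Y k) (Y i) ω ∂μ
      = ∫ ω, exceed Y i j ω * exceed Y i k ω ∂μ := by
  set f : ℝ × ℝ → ℝ := fun q => if q.2 > q.1 then 1 else 0 with hf
  have hfm : Measurable f :=
    Measurable.ite (measurableSet_lt measurable_fst measurable_snd) measurable_const
      measurable_const
  have hc : ∀ l, i ≠ l → condProbGT μ (Y l) (Y i)
      =ᵐ[μ] fun ω => ∫ y, f (Y i ω, y) ∂(μ.map (Y l)) := fun l hl =>
    condExp_prod_ae_eq_integral_map (hY i) (hY l) (hind.indepFun hl) hfm.stronglyMeasurable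
      (integrable_exceed hY i l)
  have hpm : ∀ l, IsProbabilityMeasure (μ.map (Y l)) := fun l =>
    Measure.isProbabilityMeasure_map (hY l).aemeasurable
  have hlaw : μ.map (fun ω => (Y i ω, (Y j ω, Y k ω)))
      = (μ.map (Y i)).prod ((μ.map (Y j)).prod (μ.map (Y k))) := by
    rw [(indepFun_iff_map_prod_eq_prod_map_map (hY i).aemeasurable
      ((hY j).prodMk (hY k)).aemeasurable).1
        (hind.indepFun_prodMk hY j k i hij.symm hik.symm).symm,
      (indepFun_iff_map_prod_eq_prod_map_map (hY j).aemeasurable (hY k).aemeasurable).1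
        (hind.indepFun hjk)]
  set g : ℝ × ℝ × ℝ → ℝ := fun q => f (q.1, q.2.1) * f (q.1, q.2.2) with hg
  have hgm : Measurable g := by fun_prop
  have hg1 : ∀ q, ‖g q‖ ≤ 1 := by
    intro q
    simp only [hg, hf]
    split_ifs <;> simp
  have hgint : Integrable g ((μ.map (Y i)).prod ((μ.map (Y j)).prod (μ.map (Y k)))) :=
    Integrable.of_bound hgm.aestronglyMeasurable 1 (ae_of_all _ hg1)
  have hGm : ∀ l, Measurable fun x => ∫ y, f (x, y) ∂(μ.map (Y l)) := fun l =>
    (hfm.stronglyMeasurable.integral_prod_right).measurable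
  calc ∫ ω, condProbGT μ (Y j) (Y i) ω * condProbGT μ (Y k) (Y i) ω ∂μ
      = ∫ ω, (∫ y, f (Y i ω, y) ∂(μ.map (Y j))) * (∫ z, f (Y i ω, z) ∂(μ.map (Y k))) ∂μ := by
        refine integral_congr_ae ?_
        filter_upwards [hc j hij, hc k hik] with ω h1 h2
        rw [h1, h2]
    _ = ∫ x, (∫ y, f (x, y) ∂(μ.map (Y j))) * (∫ z, f (x, z) ∂(μ.map (Y k))) ∂(μ.map (Y i)) :=
        (integral_map (hY i).aemeasurable ((hGm j).mul (hGm k)).aestronglyMeasurable).symm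
    -- For fixed x the two integrals are over independent coordinates, so their product is one
    -- integral over the product law.
    _ = ∫ x, ∫ q, g (x, q) ∂((μ.map (Y j)).prod (μ.map (Y k))) ∂(μ.map (Y i)) := by
        refine integral_congr_ae (ae_of_all _ fun x => ?_)
        exact (integral_prod_mul (fun y => f (x, y)) (fun z => f (x, z))).symm
    _ = ∫ q, g q ∂((μ.map (Y i)).prod ((μ.map (Y j)).prod (μ.map (Y k)))) :=
        (integral_prod g hgint).symm
    _ = ∫ ω, g (Y i ω, (Y j ω, Y k ω)) ∂μ := by
        rw [← hlaw, integral_map ((hY i).prodMk ((hY j).prodMk (hY k))).aemeasurable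
          hgm.aestronglyMeasurable]
    _ = _ := rfl

end Conditional

/-! ### Rates -/

lemma tendsto_rpow_mul_log :
    Tendsto (fun n : ℕ => (n : ℝ) ^ (-(1 / 6) : ℝ) * Real.log n) atTop (𝓝 0) := by
  have h := (isLittleO_log_rpow_atTop (r := 1 / 6) (by norm_num)).tendsto_div_nhds_zero
  refine (h.comp tendsto_natCast_atTop_atTop).congr fun n => ?_
  simp only [Function.comp_apply]
  rw [Real.rpow_neg (Nat.cast_nonneg n), div_eq_inv_mul]

lemma rpow_mul_log_sq (n : ℕ) : (n : ℝ) ^ (-(1 / 3) : ℝ) * Real.log n ^ 2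
    = ((n : ℝ) ^ (-(1 / 6) : ℝ) * Real.log n) ^ 2 := by
  rw [mul_pow, ← Real.rpow_natCast ((n : ℝ) ^ (-(1 / 6) : ℝ)) 2, ← Real.rpow_mul (Nat.cast_nonneg n)]
  norm_num

/-- Cesàro means of a null sequence; the term 0⁻¹ is 0. -/
lemma tendsto_sum_inv_div :
    Tendsto (fun n : ℕ => (∑ i : Fin n, (i : ℝ)⁻¹) / n) atTop (𝓝 0) := by
  refine (tendsto_inv_atTop_nhds_zero_nat (𝕜 := ℝ)).cesaro.congr fun n => ?_
  rw [Fin.sum_univ_eq_sum_range (fun i => (i : ℝ)⁻¹), div_eq_inv_mul]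

/-! ### Constants and variance for the array -/

section Array

variable {Ω : Type*} [MeasurableSpace Ω] {μ : Measure Ω} [IsProbabilityMeasure μ]
  {n : ℕ} {Y : Fin n → Ω → ℝ}

lemma measure_tie_eq_zero (hY : ∀ i, Measurable (Y i)) (hind : iIndepFun Y μ)
    (hac : ∀ i, μ.map (Y i) ≪ volume) {i j : Fin n} (hij : i ≠ j) :
    μ {ω | Y i ω = Y j ω} = 0 :=
  le_antisymm (measure_tie_le (hY i) (hY j) (hind.indepFun hij) fun y =>
    (hac j (measure_singleton y)).le) zero_le

lemma ae_injective (hY : ∀ i, Measurable (Y i)) (hind : iIndepFun Y μ)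
    (hac : ∀ i, μ.map (Y i) ≪ volume) : ∀ᵐ ω ∂μ, Function.Injective fun i => Y i ω := by
  have h : ∀ᵐ ω ∂μ, ∀ i j, i ≠ j → Y i ω ≠ Y j ω := by
    simp_rw [ae_all_iff]
    intro i j hij
    have := measure_tie_eq_zero hY hind hac hij
    simpa [ae_iff] using this
  filter_upwards [h] with ω hω i j hij
  by_contra hne
  exact hω i j hne hij

/-- Without ties, `P(X_i > X_j) ≈ θ` for all `i ≠ j` forces `θ ≈ 1 / 2`. -/
lemma abs_sub_half_le (hn : 2 ≤ n) (hY : ∀ i, Measurable (Y i))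
    (htie : ∀ i j, i ≠ j → μ.real {ω | Y i ω = Y j ω} = 0) {θ r : ℝ}
    (hθ : ∀ i j, i ≠ j → |∫ ω, exceed Y i j ω ∂μ - θ| ≤ r) : |θ - 1 / 2| ≤ r := by
  have h01 : (⟨0, by omega⟩ : Fin n) ≠ ⟨1, by omega⟩ := by simp
  have h1 := abs_le.1 (abs_integral_exceed_add_sub_one_le hY (htie _ _ h01).le)
  have h2 := abs_le.1 (hθ _ _ h01)
  have h3 := abs_le.1 (hθ _ _ h01.symm)
  exact abs_le.2 ⟨by linarith, by linarith⟩

/-- Without ties, `P(X_i < X_j, X_i < X_k) ≈ κ` for all distinct `i, j, k` forces `κ ≈ 1 / 3`. -/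
lemma abs_sub_third_le (hn : 3 ≤ n) (hY : ∀ i, Measurable (Y i))
    (htie : ∀ i j, i ≠ j → μ.real {ω | Y i ω = Y j ω} = 0) {κ r : ℝ}
    (hκ : ∀ i j k, i ≠ j → i ≠ k → j ≠ k →
      |∫ ω, exceed Y i j ω * exceed Y i k ω ∂μ - κ| ≤ r) : |κ - 1 / 3| ≤ r := by
  have h01 : (⟨0, by omega⟩ : Fin n) ≠ ⟨1, by omega⟩ := by simp
  have h02 : (⟨0, by omega⟩ : Fin n) ≠ ⟨2, by omega⟩ := by simp
  have h12 : (⟨1, by omega⟩ : Fin n) ≠ ⟨2, by omega⟩ := by simp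
  have h0 := abs_le.1 (abs_integral_exceed_mul_add_sub_one_le hY (htie _ _ h01).le
    (htie _ _ h02).le (htie _ _ h12).le)
  have h1 := abs_le.1 (hκ _ _ _ h01 h02 h12)
  have h2 := abs_le.1 (hκ _ _ _ h01.symm h12 h02)
  have h3 := abs_le.1 (hκ _ _ _ h02.symm h12.symm h01)
  exact abs_le.2 ⟨by linarith, by linarith⟩

/-- For independent observations without ties whose order probabilities are nearly those of an
i.i.d. sample, the variance of `U^AP` is close to `1 / (12 n)`. -/
lemma abs_variance_apStat_sub_of_near (hn : 2 ≤ n) (hY : ∀ i, Measurable (Y i))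
    (hind : iIndepFun Y μ) (htie : ∀ i j, i ≠ j → μ.real {ω | Y i ω = Y j ω} = 0) {r : ℝ}
    (hr : 0 ≤ r) (hhalf : ∀ i j, i ≠ j → |∫ ω, exceed Y i j ω ∂μ - 1 / 2| ≤ r)
    (hthird : ∀ i j k, i ≠ j → i ≠ k → j ≠ k →
      |∫ ω, exceed Y i j ω * exceed Y i k ω ∂μ - 1 / 3| ≤ r) :
    |((n : ℝ) - 1) ^ 2 * Var[apStat Y; μ] - 1 / 12 * n|
      ≤ 45 * r * n + 2 * ∑ i : Fin n, (i : ℝ)⁻¹ + 1 := by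
  refine (abs_variance_apStat_sub_le (ε := 3 * r) hn hY hind (by positivity)
    (by norm_num [abs_of_pos]) (fun i j hij => (htie i j hij).le.trans (by positivity))
    fun i j k hij hik hjk => abs_covariance_exceed_sub_le hY (hhalf i j hij) (hhalf i k hik)
      (hthird i j k hij hik hjk)).trans (le_of_eq ?_)
  ring

end Array

/-- With N = (n - 1)², v the true and b the bootstrap variance, the difference is (N b - N v)/(N v),
and N v ≥ n/12 - n/24 = n/24. -/
lemma abs_inv_sq_mul_sub_le {n N v b A B : ℝ} (hn : 0 < n) (hN : 0 ≤ N)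
    (hv : |N * v - 1 / 12 * n| ≤ A) (hb : |N * b - 1 / 12 * n| ≤ B) (hA : A ≤ n / 24) (hv0 : 0 < v) :
    |(v⁻¹) * b - v⁻¹ * v| ≤ 24 * ((A + B) / n) := by
  have h1 := abs_le.1 hv
  have h2 := abs_le.1 hb
  have h3 : n / 24 ≤ N * v := by linarith
  have hAB : 0 ≤ A + B := add_nonneg ((abs_nonneg _).trans hv) ((abs_nonneg _).trans hb)
  have h4 : |N * b - N * v| ≤ A + B := abs_le.2 ⟨by linarith, by linarith⟩
  have hN0 : N ≠ 0 := by
    rintro rfl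
    linarith
  have h5 : v⁻¹ * b - v⁻¹ * v = (N * b - N * v) / (N * v) := by
    field_simp
  rw [h5, abs_div, abs_of_pos (by linarith : 0 < N * v)]
  calc |N * b - N * v| / (N * v) ≤ (A + B) / (n / 24) := by gcongr
    _ = _ := by field_simp

/-! ### Assembly -/

theorem mainTheorem10
    {Ω : ℕ → Type*} [∀ n, MeasurableSpace (Ω n)]
    (P : (n : ℕ) → Measure (Ω n)) [∀ n, IsProbabilityMeasure (P n)]
    (X : (n : ℕ) → Fin n → Ω n → ℝ)
    (hX_meas : ∀ n i, Measurable (X n i))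
    (hX_indep : ∀ n, iIndepFun (X n) (P n))
    (hX_ac : ∀ n i, (P n).map (X n i) ≪ volume)
    (δ p : ℕ → ℝ)
    (hδ : ∀ n, δ n ∈ Set.Ioo (0 : ℝ) 1)
    (hp : ∀ n, p n ∈ Set.Ioo (0 : ℝ) 1)
    (hδp : ∀ᶠ n in atTop, ∀ i : Fin n,
      p n ≤ (P n).real {ω | ∀ j : Fin n, j ≠ i →
        condProbGT (P n) (X n j) (X n i) ω - (P n).real {ω' | X n j ω' > X n i ω'}
          ∈ Set.Icc (δ n) 1} ∨
      p n ≤ (P n).real {ω | ∀ j : Fin n, j ≠ i →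
        condProbGT (P n) (X n j) (X n i) ω - (P n).real {ω' | X n j ω' > X n i ω'}
          ∈ Set.Icc (-1) (-δ n)})
    (hrate : StrictlyDominates (fun n => δ n ^ 3 * p n)
      (fun n => (n : ℝ) ^ (-(1 / 3) : ℝ) * Real.log n ^ 2))
    (θ : ℝ) (hθ : 0 < θ) (C₁ : ℝ) (hC₁ : 0 < C₁)
    (hθ_approx : ∀ n, ∀ i j : Fin n, i ≠ j →
      |(P n).real {ω | X n i ω > X n j ω} - θ|
        ≤ C₁ * (n : ℝ) ^ (-(1 / 6) : ℝ) * Real.log n)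
    (η : ℝ) (hη : 0 < η ^ 2) (C₂ : ℝ) (hC₂ : 0 < C₂)
    (hη_approx : ∀ n, ∀ i j k : Fin n, j ≠ i → k ≠ i →
      |(∫ ω, condProbGT (P n) (X n j) (X n i) ω * condProbGT (P n) (X n k) (X n i) ω ∂(P n))
          - η ^ 2|
        ≤ C₂ * (n : ℝ) ^ (-(1 / 3) : ℝ) * Real.log n ^ 2)
    (hηθ : η ^ 2 ≠ θ ^ 2) :
    (∀ᶠ n in atTop, 0 < apSigma (P n) (X n)) ∧
    ∀ ε : ℝ, 0 < ε →
      Tendsto (fun n => P n {ω | ε ≤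
        |bootstrapVariance (fun x => (apSigma (P n) (X n))⁻¹ * apU n x) (fun i => X n i ω)
          - variance (fun ω' => (apSigma (P n) (X n))⁻¹ * apStat (X n) ω') (P n)|})
        atTop (𝓝 0) := by
  have htie : ∀ n, ∀ i j : Fin n, i ≠ j → (P n).real {ω | X n i ω = X n j ω} = 0 := by
    intro n i j hij
    simp [Measure.real, measure_tie_eq_zero (hX_meas n) (hX_indep n) (hX_ac n) hij]
  set r : ℕ → ℝ := fun n => (n : ℝ) ^ (-(1 / 6) : ℝ) * Real.log n with hr
  have hr0 : Tendsto r atTop (𝓝 0) := tendsto_rpow_mul_log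
  have hr2 : Tendsto (fun n => r n ^ 2) atTop (𝓝 0) := by simpa using hr0.pow 2
  have hrn : ∀ n, 0 ≤ r n := fun n =>
    mul_nonneg (Real.rpow_nonneg (Nat.cast_nonneg n) _) (Real.log_natCast_nonneg n)
  have hpair : ∀ n, ∀ i j : Fin n, i ≠ j →
      |∫ ω, exceed (X n) i j ω ∂(P n) - θ| ≤ C₁ * r n := by
    intro n i j hij
    rw [integral_exceed (hX_meas n), hr]
    simpa [mul_assoc] using hθ_approx n j i hij.symm
  have htriple : ∀ n, ∀ i j k : Fin n, i ≠ j → i ≠ k → j ≠ k →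
      |∫ ω, exceed (X n) i j ω * exceed (X n) i k ω ∂(P n) - η ^ 2| ≤ C₂ * r n ^ 2 := by
    intro n i j k hij hik hjk
    rw [← integral_condProbGT_mul (hX_meas n) (hX_indep n) hij hik hjk, hr]
    simp only
    rw [← rpow_mul_log_sq, ← mul_assoc]
    exact hη_approx n i j k hij.symm hik.symm
  -- A constant whose distance to 1/2 is bounded by a null sequence equals 1/2; likewise for η²
  -- below.
  have hθ2 : θ = 1 / 2 := by
    have h : |θ - 1 / 2| ≤ 0 := by
      refine ge_of_tendsto (by simpa using hr0.const_mul C₁) ?_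
      filter_upwards [eventually_ge_atTop 2] with n hn
      exact abs_sub_half_le hn (hX_meas n) (htie n) (hpair n)
    linarith [abs_nonpos_iff.1 h]
  have hη3 : η ^ 2 = 1 / 3 := by
    have h : |η ^ 2 - 1 / 3| ≤ 0 := by
      refine ge_of_tendsto (by simpa using hr2.const_mul C₂) ?_
      filter_upwards [eventually_ge_atTop 3] with n hn
      exact abs_sub_third_le hn (hX_meas n) (htie n) (htriple n)
    linarith [abs_nonpos_iff.1 h]
  rw [hθ2] at hpair
  rw [hη3] at htriple
  set ρ : ℕ → ℝ := fun n => C₁ * r n + C₂ * r n ^ 2 with hρ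
  set H : ℕ → ℝ := fun n => ∑ i : Fin n, (i : ℝ)⁻¹ with hH
  set A : ℕ → ℝ := fun n => 45 * ρ n * n + 2 * H n + 1 with hA
  set B : ℕ → ℝ := fun n => 2 * H n + 46 with hB
  have hvar : ∀ n : ℕ, 2 ≤ n →
      |((n : ℝ) - 1) ^ 2 * Var[apStat (X n); P n] - 1 / 12 * n| ≤ A n := by
    intro n hn
    have h1 : 0 ≤ C₁ * r n := mul_nonneg hC₁.le (hrn n)
    have h2 : 0 ≤ C₂ * r n ^ 2 := by positivity
    refine abs_variance_apStat_sub_of_near hn (hX_meas n) (hX_indep n) (htie n) (r := ρ n)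
      (add_nonneg h1 h2) (fun i j hij => (hpair n i j hij).trans ?_)
      (fun i j k hij hik hjk => (htriple n i j k hij hik hjk).trans ?_)
    · simp only [hρ]
      linarith
    · simp only [hρ]
      linarith
  have hH0 : Tendsto (fun n => H n / n) atTop (𝓝 0) := tendsto_sum_inv_div
  have hi0 : Tendsto (fun n : ℕ => (n : ℝ)⁻¹) atTop (𝓝 0) := tendsto_inv_atTop_nhds_zero_nat
  have hρ0 : Tendsto ρ atTop (𝓝 0) := by
    simpa using (hr0.const_mul C₁).add (hr2.const_mul C₂)
  have hA0 : Tendsto (fun n => A n / n) atTop (𝓝 0) := by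
    have h := ((hρ0.const_mul 45).add (hH0.const_mul 2)).add hi0
    simp only [mul_zero, add_zero] at h
    refine h.congr' ?_
    filter_upwards [eventually_gt_atTop 0] with n hn
    have : (n : ℝ) ≠ 0 := by positivity
    simp only [hA]
    field_simp
  have hB0 : Tendsto (fun n => B n / n) atTop (𝓝 0) := by
    have h := (hH0.const_mul 2).add (hi0.const_mul 46)
    simp only [mul_zero, add_zero] at h
    refine h.congr fun n => ?_
    simp only [hB]
    ring
  have hAsmall : ∀ᶠ n : ℕ in atTop, A n ≤ n / 24 := by
    filter_upwards [hA0.eventually_le_const (show (0 : ℝ) < 1 / 24 by norm_num),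
      eventually_gt_atTop 0] with n h hn
    rw [div_le_iff₀ (by positivity)] at h
    linarith
  have hVpos : ∀ᶠ n in atTop, 0 < Var[apStat (X n); P n] := by
    filter_upwards [hAsmall, eventually_ge_atTop 2] with n h1 hn
    have h2 := abs_le.1 (hvar n hn)
    have h3 : (0 : ℝ) < n := by positivity
    exact pos_of_mul_pos_right (by linarith : 0 < ((n : ℝ) - 1) ^ 2 * Var[apStat (X n); P n])
      (sq_nonneg _)
  refine ⟨hVpos.mono fun n h => Real.sqrt_pos.2 h, fun ε hε => ?_⟩
  have hlim : Tendsto (fun n => 24 * ((A n + B n) / n)) atTop (𝓝 0) := by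
    simpa [add_div] using (hA0.add hB0).const_mul 24
  refine tendsto_const_nhds.congr' ?_
  filter_upwards [hAsmall, hVpos, hlim.eventually_lt_const hε, eventually_ge_atTop 2]
    with n h1 h2 h3 hn
  have hnpos : (0 : ℝ) < n := by positivity
  have hsq : (apSigma (P n) (X n))⁻¹ ^ 2 = (Var[apStat (X n); P n])⁻¹ := by
    rw [inv_pow, apSigma, Real.sq_sqrt h2.le]
  -- For large n the deviation event is null, since the error bound is deterministic for distinct
  -- data.
  refine (measure_eq_zero_iff_ae_notMem.2 ?_).symm
  filter_upwards [ae_injective (hX_meas n) (hX_indep n) (hX_ac n)] with ω hω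
  simp only [not_le]
  rw [bootstrapVariance, variance_const_mul, variance_const_mul, hsq]
  exact (abs_inv_sq_mul_sub_le hnpos (sq_nonneg _) (hvar n hn)
    (abs_bootstrapVariance_sub_le hn hω) h1 h2).trans_lt h3
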